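/- Let $\mathcal A$ be a unital C*-algebra, let $\mathcal V$ be a norm-closed linear subspace of $\mathcal A$, and let $n$ be a natural number. Let $M_n(\mathcal A)$ be the C*-algebra of $n\times n$ matrices over $\mathcal A$, with its unique C*-norm, and let $M_n(\mathcal V)$ be its subspace of matrices with entries in $\mathcal V$. Let $\psi$ be a bounded linear functional on $M_n(\mathcal A)$ with $\|\psi\| = 1$ and $\psi(M_n(\mathcal V)) = 0$. Then there exist a unital $*$-representation $(\mathcal H,\pi)$ of $\mathcal A$ on a complex Hilbert space and two (orthogonal) projections $P, Q \in \mathcal L(\mathcal H)$, each of rank at most $n$, such that the linear map $\Psi:\mathcal A \to \mathcal L(\mathcal H)$ defined by $$\Psi(A) = Q\,\pi(A)\,P \qquad (A \in \mathcal A)$$ has the following properties. For each $k$ let $\Psi_k : M_k(\mathcal A) \to M_k(\mathcal L(\mathcal H))$ be the map that applies $\Psi$ to each entry. 1. $\Psi$ is completely contractive, that is, $\|\Psi_k(C)\| \le \|C\|$ for every $k$ and every $C \in M_k(\mathcal A)$, where $M_k(\mathcal A)$ and $M_k(\mathcal L(\mathcal H))$ carry their C*-norms. 2. $\Psi(\mathcal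 V) = 0$. 3. There are unit vectors $\xi, \eta$ in the Hilbert space direct sum $\mathcal H^{\oplus n}$ such that $$\psi(C) = \langle \Psi_n(C)\xi, \eta\rangle \qquad \text{for all } C \in M_n(\mathcal A),$$ where $\Psi_n(C)$ acts on $\mathcal H^{\oplus n}$ by $(\Psi_n(C)\xi)_i = \sum_{j} \Psi(C_{ij})\xi_j$ and the inner product is linear in its first variable. -/

import Mathlib

universe u v

/-- A linear map `φ : A → B` between C⋆-algebras is completely contractive if, for every `k`,
its entrywise extension `φ_k : M_k(A) → M_k(B)` has norm at most one, where the matrix algebras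
carry their C⋆-algebra norms. -/
def IsCompletelyContractive {A : Type u} {B : Type v}
    [CStarAlgebra A] [PartialOrder A] [StarOrderedRing A]
    [CStarAlgebra B] [PartialOrder B] [StarOrderedRing B] (φ : A →ₗ[ℂ] B) : Prop :=
  ∀ (k : ℕ) (C : CStarMatrix (Fin k) (Fin k) A), ‖C.map φ‖ ≤ ‖C‖

/-- The linear map `a ↦ Q π(a) P` from `A` to the bounded operators on `H`. -/
noncomputable def compressedRep {A : Type u} [CStarAlgebra A]
    {H : Type v} [NormedAddCommGroup H] [InnerProductSpace ℂ H] [CompleteSpace H]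
    (π : A →⋆ₐ[ℂ] (H →L[ℂ] H)) (Q P : H →L[ℂ] H) : A →ₗ[ℂ] (H →L[ℂ] H) where
  toFun a := Q * π a * P
  map_add' a b := by rw [map_add, mul_add, add_mul]
  map_smul' c a := by rw [map_smul, mul_smul_comm, smul_mul_assoc, RingHom.id_apply]

/-- The action of an `n × n` matrix of bounded operators on `H` on the Hilbert space direct sum
`H^{⊕n}`: the `i`-th component of `T ξ` is `∑ j, T i j (ξ j)`. -/
noncomputable def operatorMatrixApply {H : Type v} [NormedAddCommGroup H] [InnerProductSpace ℂ H]
    {n : ℕ} (T : CStarMatrix (Fin n) (Fin n) (H →L[ℂ] H))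
    (ξ : PiLp 2 (fun _ : Fin n => H)) : PiLp 2 (fun _ : Fin n => H) :=
  WithLp.toLp 2 (fun i => ∑ j, T i j (ξ j))

/-! A norm-one `ψ` is dominated by a state: `|ψ(b)|² ≤ φ(b b⋆)` (`exists_state_norm_sq_le`). The
state comes from a Hahn–Banach separation. Riesz representation in the GNS space of `φ` then gives
`ψ(b) = ⟪y, ρ(b) x⟫` with unit vectors (`exists_representation_eq_inner`).

For matrices, the GNS space need not be split into `n` copies of a smaller one: `π` is `ρ` on
constant diagonal matrices, acting on the whole space. Matrix units cut `x` and `y` into components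
`u j`, `w i`, and `ψ(C) = ∑ ⟪w i, π(C i j) u j⟫`. `P` and `Q` project onto the spans of the `u j`
and of the `w i`. Evaluating `ψ` on single-entry matrices shows `π(V) u j ⟂ w i`, hence `Q π(V) P =
0`. -/

open scoped ComplexOrder InnerProductSpace

/-! ### Domination of a contractive functional by a state -/

section StateDomination

variable {B : Type u} [CStarAlgebra B] [PartialOrder B] [StarOrderedRing B]

/-- The elements of a C⋆-algebra whose real part is negative and bounded away from zero. -/
def strictlyNegativeRealPart (B : Type u) [CStarAlgebra B] [PartialOrder B] : Set B :=
  {c | ∃ ε : ℝ, 0 < ε ∧ c + star c ≤ -algebraMap ℝ B ε}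

theorem convex_strictlyNegativeRealPart : Convex ℝ (strictlyNegativeRealPart B) := by
  rintro c ⟨ε, hε, hc⟩ d ⟨δ, hδ, hd⟩ s t hs ht hst
  refine ⟨s * ε + t * δ, ?_, ?_⟩
  · rcases hs.eq_or_lt with rfl | hs
    · have : t = 1 := by linarith
      simp [this, hδ]
    · positivity
  · have h := add_le_add (smul_le_smul_of_nonneg_left hc hs) (smul_le_smul_of_nonneg_left hd ht)
    convert h using 1
    · simp only [star_add, star_smul, star_trivial, smul_add]; abel
    · simp only [Algebra.algebraMap_eq_smul_one, smul_neg, smul_smul, add_smul]; abel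

theorem isOpen_strictlyNegativeRealPart : IsOpen (strictlyNegativeRealPart B) := by
  rw [Metric.isOpen_iff]
  rintro c ⟨ε, hε, hc⟩
  -- Moving `c` by less than `ε / 4` moves `c + star c` by at most `ε / 2`.
  refine ⟨ε / 4, by positivity, fun d hd => ⟨ε / 2, by positivity, ?_⟩⟩
  rw [Metric.mem_ball, dist_eq_norm] at hd
  have hsa : IsSelfAdjoint ((d - c) + star (d - c)) := IsSelfAdjoint.add_star_self _
  have hle : (d - c) + star (d - c) ≤ algebraMap ℝ B (ε / 2) := by
    refine hsa.le_algebraMap_norm_self.trans (algebraMap_mono B ?_)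
    refine (norm_add_le _ _).trans ?_
    rw [norm_star]
    linarith
  have h := add_le_add hc hle
  convert h using 1
  · rw [star_sub]; abel
  · rw [← map_neg, ← map_neg, ← map_add]; congr 1; ring

theorem smul_mem_strictlyNegativeRealPart {c : B} (hc : c ∈ strictlyNegativeRealPart B)
    {t : ℝ} (ht : 0 < t) : t • c ∈ strictlyNegativeRealPart B := by
  obtain ⟨ε, hε, hc⟩ := hc
  refine ⟨t * ε, by positivity, ?_⟩
  have h := smul_le_smul_of_nonneg_left hc ht.le
  convert h using 1
  · simp [star_smul]
  · simp [Algebra.algebraMap_eq_smul_one, smul_smul]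

theorem sub_algebraMap_mem_strictlyNegativeRealPart {c : B} (hc : c + star c ≤ 0)
    {ε : ℝ} (hε : 0 < ε) : c - algebraMap ℝ B ε ∈ strictlyNegativeRealPart B := by
  refine ⟨2 * ε, by positivity, ?_⟩
  have h := add_le_add_left hc (-algebraMap ℝ B (2 * ε))
  convert h using 1
  · simp only [Algebra.algebraMap_eq_smul_one, star_sub, star_smul, star_one, star_trivial,
      two_mul, add_smul]
    abel
  · simp

/-- The upward closure of the elements `b b⋆ + 1 - 2 Re ψ(b)`. -/
def quadraticUpperSet (ψ : StrongDual ℂ B) : Set B :=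
  {c | ∃ b : B, b * star b + algebraMap ℝ B (1 - 2 * (ψ b).re) ≤ c}

theorem convexCombination_mul_star_le (b d : B) {s t : ℝ} (hs : 0 ≤ s) (ht : 0 ≤ t)
    (hst : s + t = 1) :
    (s • b + t • d) * star (s • b + t • d) ≤ s • (b * star b) + t • (d * star d) := by
  rw [← sub_nonneg]
  have h : s • (b * star b) + t • (d * star d) - (s • b + t • d) * star (s • b + t • d)
      = (s * t) • ((b - d) * star (b - d)) := by
    obtain rfl : t = 1 - s := by linarith
    simp only [star_add, star_smul, star_trivial, star_sub, add_mul, mul_add, sub_mul, mul_sub,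
      smul_mul_assoc, mul_smul_comm]
    module
  rw [h]
  exact smul_nonneg (mul_nonneg hs ht) (mul_star_self_nonneg _)

theorem convex_quadraticUpperSet (ψ : StrongDual ℂ B) : Convex ℝ (quadraticUpperSet ψ) := by
  rintro c ⟨b, hc⟩ d ⟨e, hd⟩ s t hs ht hst
  refine ⟨s • b + t • e, ?_⟩
  have h := add_le_add (smul_le_smul_of_nonneg_left hc hs) (smul_le_smul_of_nonneg_left hd ht)
  refine le_trans ?_ h
  have hre : (ψ (s • b + t • e)).re = s * (ψ b).re + t * (ψ e).re := by
    rw [map_add, ← Complex.coe_smul, ← Complex.coe_smul, map_smul, map_smul]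
    simp
  have heq : s • (b * star b + algebraMap ℝ B (1 - 2 * (ψ b).re)) +
      t • (e * star e + algebraMap ℝ B (1 - 2 * (ψ e).re)) =
      s • (b * star b) + t • (e * star e) +
        algebraMap ℝ B (1 - 2 * (ψ (s • b + t • e)).re) := by
    rw [hre]
    obtain rfl : t = 1 - s := by linarith
    simp only [Algebra.algebraMap_eq_smul_one]
    module
  rw [heq]
  exact add_le_add_left (convexCombination_mul_star_le b e hs ht hst) _

/-- A common element would give `‖b‖² < 2 Re ψ(b) - 1 ≤ 2‖b‖ - 1`, contradicting `(‖b‖ - 1)² ≥ 0`.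
-/
theorem disjoint_strictlyNegativeRealPart_quadraticUpperSet [Nontrivial B] {ψ : StrongDual ℂ B}
    (hψ : ‖ψ‖ ≤ 1) : Disjoint (strictlyNegativeRealPart B) (quadraticUpperSet ψ) := by
  rw [Set.disjoint_left]
  rintro c ⟨ε, hε, hc⟩ ⟨b, hb⟩
  have h₁ := add_le_add hb (star_le_star_iff.mpr hb)
  have h₂ : (2 : ℝ) • (b * star b) ≤ algebraMap ℝ B (2 * (2 * (ψ b).re - 1) - ε) := by
    have h₃ := add_le_add_left (h₁.trans hc) (algebraMap ℝ B (2 * (2 * (ψ b).re - 1)))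
    convert h₃ using 1
    · simp only [star_add, star_mul, star_star, Algebra.algebraMap_eq_smul_one, star_smul,
        star_trivial, star_one]
      module
    · simp only [Algebra.algebraMap_eq_smul_one]
      module
  have h₃ : ‖(2 : ℝ) • (b * star b)‖ ≤ 2 * (2 * (ψ b).re - 1) - ε := by
    have h0 : (0 : B) ≤ (2 : ℝ) • (b * star b) :=
      smul_nonneg zero_le_two (mul_star_self_nonneg b)
    have hnn : (0 : ℝ) ≤ 2 * (2 * (ψ b).re - 1) - ε := by
      have := h0.trans h₂
      rwa [← map_zero (algebraMap ℝ B), algebraMap_le_algebraMap] at this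
    exact (CStarAlgebra.norm_le_iff_le_algebraMap _ hnn h0).mpr h₂
  rw [norm_smul, CStarRing.norm_self_mul_star, Real.norm_ofNat] at h₃
  have h₄ : (ψ b).re ≤ ‖b‖ :=
    (Complex.re_le_norm _).trans ((ψ.le_opNorm b).trans
      (mul_le_of_le_one_left (norm_nonneg _) hψ))
  nlinarith [sq_nonneg (‖b‖ - 1)]

/-- Every contractive functional `ψ` on a C⋆-algebra is dominated by a state `φ` in the sense
that `|ψ(b)|² ≤ φ(b b⋆)`. -/
theorem exists_state_norm_sq_le [Nontrivial B] {ψ : StrongDual ℂ B} (hψ : ‖ψ‖ ≤ 1) :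
    ∃ φ : B →ₚ[ℂ] ℂ, φ 1 = 1 ∧ ∀ b, ‖ψ b‖ ^ 2 ≤ (φ (b * star b)).re := by
  obtain ⟨g, s, hgU, hgK⟩ := RCLike.geometric_hahn_banach_open (𝕜 := ℂ)
    convex_strictlyNegativeRealPart isOpen_strictlyNegativeRealPart (convex_quadraticUpperSet ψ)
    (disjoint_strictlyNegativeRealPart_quadraticUpperSet hψ)
  simp only [RCLike.re_eq_complex_re] at hgU hgK
  have hreal (t : ℝ) (c : B) : (g (t • c)).re = t * (g c).re := by
    rw [← Complex.coe_smul, map_smul]; simp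
  -- The set is a cone, so a functional bounded above on it is nonpositive there.
  have hneg (c : B) (hc : c ∈ strictlyNegativeRealPart B) : (g c).re ≤ 0 := by
    by_contra! h
    have h1 := hgU _ (smul_mem_strictlyNegativeRealPart hc (t := (|s| + 1) / (g c).re)
      (by positivity))
    rw [hreal, div_mul_cancel₀ _ h.ne'] at h1
    linarith [le_abs_self s]
  have hnonpos (c : B) (hc : c + star c ≤ 0) : (g c).re ≤ 0 := by
    refine le_of_forall_pos_le_add fun ε hε => ?_
    have hδ : 0 < ε / (|(g 1).re| + 1) := by positivity
    have h1 := hneg _ (sub_algebraMap_mem_strictlyNegativeRealPart hc hδ)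
    rw [map_sub, Complex.sub_re, Algebra.algebraMap_eq_smul_one, hreal] at h1
    have h2 : ε / (|(g 1).re| + 1) * (g 1).re ≤ ε := by
      rw [div_mul_eq_mul_div, div_le_iff₀ (by positivity)]
      nlinarith [le_abs_self (g 1).re]
    linarith
  -- The cone has points arbitrarily close to `0`.
  have hs : 0 ≤ s := by
    by_contra! h
    have hm := sub_algebraMap_mem_strictlyNegativeRealPart (B := B) (c := 0) (by simp) zero_lt_one
    have h2 := hgU _ (smul_mem_strictlyNegativeRealPart hm
      (t := -s / (|(g (0 - algebraMap ℝ B 1)).re| + 1)) (div_pos (by linarith) (by positivity)))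
    rw [hreal, div_mul_eq_mul_div, div_lt_iff₀ (by positivity)] at h2
    nlinarith [neg_abs_le (g (0 - algebraMap ℝ B 1)).re]
  have hpos (p : B) (hp : 0 ≤ p) : 0 ≤ g p := by
    have hsp : star p = p := (IsSelfAdjoint.of_nonneg hp).star_eq
    have hre := hnonpos (-p) (by
      rw [star_neg, hsp, ← neg_add, neg_nonpos]; exact add_nonneg hp hp)
    -- Both `±i p` have zero real part, which forces `g p` to be real.
    have him₁ := hnonpos (Complex.I • p) (by simp [star_smul, hsp])
    have him₂ := hnonpos (-(Complex.I • p)) (by simp [star_smul, hsp])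
    simp only [map_neg, map_smul, Complex.neg_re, smul_eq_mul, Complex.mul_re, Complex.I_re,
      Complex.I_im] at hre him₁ him₂
    rw [Complex.nonneg_iff]
    constructor <;> linarith
  have hK (b : B) : s ≤ (g (b * star b)).re + (1 - 2 * (ψ b).re) * (g 1).re := by
    have h := hgK _ ⟨b, le_rfl⟩
    rwa [map_add, Complex.add_re, Algebra.algebraMap_eq_smul_one, hreal] at h
  have hone : 0 < (g 1).re := by
    have h1 := hgU _ (sub_algebraMap_mem_strictlyNegativeRealPart (B := B) (c := 0) (by simp)
      zero_lt_one)
    have h2 := hK 0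
    simp only [map_one, zero_sub, map_neg, Complex.neg_re, star_zero, mul_zero, map_zero,
      Complex.zero_re, sub_zero, one_mul, zero_add] at h1 h2
    linarith
  have him : ((g 1).re : ℂ) = g 1 :=
    (Complex.eq_re_of_ofReal_le (r := 0) (by simpa using hpos 1 zero_le_one)).symm
  have hmono : Monotone (((g 1).re⁻¹ : ℂ) • (g : B →ₗ[ℂ] ℂ)) := by
    intro a b hab
    have h := hpos (b - a) (sub_nonneg.mpr hab)
    rw [map_sub, sub_nonneg] at h
    have h' : (0 : ℂ) ≤ ((g 1).re⁻¹ : ℂ) := by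
      rw [← Complex.ofReal_inv]; exact_mod_cast (inv_pos.mpr hone).le
    exact mul_le_mul_of_nonneg_left h h'
  let φ : B →ₚ[ℂ] ℂ := { ((g 1).re⁻¹ : ℂ) • (g : B →ₗ[ℂ] ℂ) with monotone' := hmono }
  have hφ (c : B) : φ c = ((g 1).re⁻¹ : ℂ) * g c := rfl
  have hφre (c : B) : (φ c).re = (g 1).re⁻¹ * (g c).re := by
    rw [hφ, ← Complex.ofReal_inv, Complex.re_ofReal_mul]
  refine ⟨φ, ?_, fun b => ?_⟩
  · rw [hφ, him]
    refine inv_mul_cancel₀ fun h => ?_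
    rw [h] at hone
    simp at hone
  have hquad (c : B) : 2 * (ψ c).re ≤ (φ (c * star c)).re + 1 := by
    rw [hφre, ← mul_le_mul_iff_right₀ hone, mul_add, mul_inv_cancel_left₀ hone.ne']
    linarith [hK c]
  have hcomplex (z : ℂ) : 2 * (z * ψ b).re ≤ ‖z‖ ^ 2 * (φ (b * star b)).re + 1 := by
    have h := hquad (z • b)
    rw [map_smul, smul_eq_mul, star_smul, smul_mul_smul_comm, map_smul, smul_eq_mul,
      Complex.star_def, Complex.mul_conj, Complex.re_ofReal_mul, Complex.normSq_eq_norm_sq] at h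
    exact h
  set q := (φ (b * star b)).re with hq
  have hq0 : 0 ≤ q := (Complex.nonneg_iff.mp (φ.map_nonneg (mul_star_self_nonneg b))).1
  -- The phase of `z` is aligned with `ψ b`; below, `t = 1 / q` is optimal, and `q = 0` forces `ψ b
  -- = 0`.
  have hz (t : ℝ) : 2 * (t * ‖ψ b‖ ^ 2) ≤ t ^ 2 * ‖ψ b‖ ^ 2 * q + 1 := by
    have h := hcomplex (t * starRingEnd ℂ (ψ b))
    rw [mul_assoc, mul_comm (starRingEnd ℂ (ψ b)), Complex.mul_conj, Complex.re_ofReal_mul,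
      Complex.ofReal_re, Complex.normSq_eq_norm_sq, norm_mul, RCLike.norm_conj, mul_pow,
      Complex.norm_real, Real.norm_eq_abs, sq_abs] at h
    exact h
  rcases hq0.eq_or_lt with h0 | h0
  · by_contra! hlt
    have h' := hz (1 / ‖ψ b‖ ^ 2)
    rw [← h0] at h' hlt
    rw [one_div, inv_mul_cancel₀ hlt.ne'] at h'
    linarith
  · have h := hz (1 / q)
    have e : (1 / q) ^ 2 * ‖ψ b‖ ^ 2 * q = ‖ψ b‖ ^ 2 / q := by field_simp
    have e' : 1 / q * ‖ψ b‖ ^ 2 = ‖ψ b‖ ^ 2 / q := by ring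
    rw [e, e'] at h
    exact (div_le_one h0).mp (by linarith)

end StateDomination

/-! ### Functionals as GNS matrix coefficients -/

section VectorFunctional

variable {B : Type u} [CStarAlgebra B] [PartialOrder B] [StarOrderedRing B]

/-- If `|ψ(b)|² ≤ φ(b b⋆)`, then `ψ` is a matrix coefficient of the GNS representation of `φ`
whose left vector is the cyclic vector. -/
theorem exists_gns_vector {φ : B →ₚ[ℂ] ℂ} {ψ : StrongDual ℂ B}
    (h : ∀ b, ‖ψ b‖ ^ 2 ≤ (φ (b * star b)).re) :
    ∃ y : φ.GNS, ‖y‖ ≤ 1 ∧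
      ∀ b, ψ b = ⟪((φ.toPreGNS 1 : φ.PreGNS) : φ.GNS), φ.gnsStarAlgHom b y⟫_ℂ := by
  let e : B →ₗ[ℂ] φ.GNS :=
    (UniformSpace.Completion.toComplL (𝕜 := ℂ) (E := φ.PreGNS) : φ.PreGNS →ₗ[ℂ] φ.GNS) ∘ₗ
      φ.toPreGNS.toLinearMap
  have he (b : B) : e b = ((φ.toPreGNS b : φ.PreGNS) : φ.GNS) := rfl
  let l : B →ₗ[ℂ] ℂ :=
    { toFun := fun b => star (ψ (star b))
      map_add' := by simp
      map_smul' := by simp [star_smul] }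
  have hl (b : B) : l b = star (ψ (star b)) := rfl
  have hdense : DenseRange e := by
    refine UniformSpace.Completion.denseRange_coe.comp ?_
      (UniformSpace.Completion.continuous_coe _)
    exact φ.toPreGNS.surjective.denseRange
  -- This bound lets the functional descend to the GNS space, where Riesz applies.
  have hnorm (b : B) : ‖l b‖ ≤ 1 * ‖e b‖ := by
    rw [hl, he, norm_star, one_mul, UniformSpace.Completion.norm_coe, φ.preGNS_norm_def]
    refine Real.le_sqrt_of_sq_le ?_
    simpa using h (star b)
  let y := (InnerProductSpace.toDual ℂ φ.GNS).symm (l.extendOfNorm e)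
  have hy (b : B) : ⟪y, e b⟫_ℂ = star (ψ (star b)) := by
    rw [InnerProductSpace.toDual_symm_apply, LinearMap.extendOfNorm_eq hdense ⟨1, hnorm⟩, hl]
  refine ⟨y, ?_, fun b => ?_⟩
  · rw [LinearIsometryEquiv.norm_map]
    exact LinearMap.opNorm_extendOfNorm_le hdense zero_le_one hnorm
  · rw [← ContinuousLinearMap.adjoint_inner_left, ← ContinuousLinearMap.star_eq_adjoint,
      ← map_star]
    have hgns : φ.gnsStarAlgHom (star b) ((φ.toPreGNS 1 : φ.PreGNS) : φ.GNS) = e (star b) := by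
      rw [he, PositiveLinearMap.gnsStarAlgHom_apply]
      erw [PositiveLinearMap.gnsNonUnitalStarAlgHom_apply_coe]
      simp
    rw [hgns, ← inner_conj_symm, hy]
    simp

/-- Every functional of norm one on a unital C⋆-algebra is a matrix coefficient, between unit
vectors, of some unital ⋆-representation. -/
theorem exists_representation_eq_inner {ψ : StrongDual ℂ B} (hψ : ‖ψ‖ = 1) :
    ∃ (H : Type u) (_ : NormedAddCommGroup H) (_ : InnerProductSpace ℂ H) (_ : CompleteSpace H)
      (ρ : B →⋆ₐ[ℂ] (H →L[ℂ] H)) (x y : H),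
      ‖x‖ = 1 ∧ ‖y‖ = 1 ∧ ∀ b, ψ b = ⟪y, ρ b x⟫_ℂ := by
  have : Nontrivial B := by
    by_contra hB
    rw [not_nontrivial_iff_subsingleton] at hB
    have : ψ = 0 := ContinuousLinearMap.ext fun b => by
      rw [Subsingleton.elim b 0, map_zero, map_zero]
    simp [this] at hψ
  obtain ⟨φ, hφ, hle⟩ := exists_state_norm_sq_le hψ.le
  obtain ⟨y, hy, hψy⟩ := exists_gns_vector hle
  have hx : ‖((φ.toPreGNS 1 : φ.PreGNS) : φ.GNS)‖ = 1 := by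
    rw [UniformSpace.Completion.norm_coe, φ.preGNS_norm_def]
    simp [hφ]
  refine ⟨φ.GNS, inferInstance, inferInstance, inferInstance, φ.gnsStarAlgHom, y, _, ?_, hx, hψy⟩
  -- The cyclic vector is a unit vector, so `1 = ‖ψ‖ ≤ ‖y‖`.
  refine le_antisymm hy ?_
  rw [← hψ]
  refine ψ.opNorm_le_bound (norm_nonneg _) fun b => ?_
  rw [hψy]
  refine (norm_inner_le_norm _ _).trans ?_
  rw [hx, one_mul, mul_comm]
  refine ((φ.gnsStarAlgHom b).le_opNorm y).trans ?_
  gcongr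
  exact NonUnitalStarAlgHom.norm_apply_le φ.gnsStarAlgHom b

end VectorFunctional

/-! ### Matrix units and constant diagonal matrices -/

namespace CStarMatrix

theorem sum_entry {ι m : Type*} {A : Type u} [CStarAlgebra A] (s : Finset ι) (f : ι → CStarMatrix m m A) (p q : m) :
    (∑ i ∈ s, f i) p q = ∑ i ∈ s, f i p q :=
  map_sum ({ toFun := fun M => M p q, map_zero' := rfl, map_add' := fun _ _ => rfl } :
    CStarMatrix m m A →+ A) f s

section MatrixUnits

variable {A : Type u} [CStarAlgebra A] {m : Type v} [DecidableEq m]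

/-- The matrix unit with a one at position `(i, j)`. -/
def unit (A : Type u) [CStarAlgebra A] (i j : m) : CStarMatrix m m A :=
  ofMatrix (Matrix.single i j 1)

theorem unit_apply (i j k l : m) :
    unit A i j k l = if i = k ∧ j = l then 1 else 0 := by
  simp [unit, Matrix.single_apply]

theorem star_unit (i j : m) : star (unit A i j) = unit A j i := by
  ext k l
  simp only [star_apply, unit_apply, and_comm (a := i = l)]
  split_ifs <;> simp

variable [Fintype m]

theorem unit_mul_unit (i j k : m) : unit A i j * unit A j k = unit A i k := by
  ext p q
  simp only [mul_apply, unit_apply, mul_ite, mul_one, mul_zero]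
  by_cases hp : i = p <;> by_cases hq : k = q <;> simp [hp, hq]

theorem sum_unit_diag : ∑ i : m, unit A i i = 1 := by
  ext p q
  rw [sum_entry]
  simp only [unit_apply, one_apply]
  by_cases h : p = q
  · simp [h]
  · simp only [h, if_false]
    exact Finset.sum_eq_zero fun i _ => if_neg fun ⟨h₁, h₂⟩ => h (h₁.symm.trans h₂)

/-- The unital ⋆-homomorphism sending `a` to the diagonal matrix with all diagonal entries `a`. -/
def diagonalStarAlgHom (m : Type v) [Fintype m] [DecidableEq m] (A : Type u) [CStarAlgebra A] :
    A →⋆ₐ[ℂ] CStarMatrix m m A where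
  toFun a := ofMatrix (Matrix.diagonal fun _ => a)
  map_one' := by
    ext i j
    simp only [ofMatrix_apply, Matrix.diagonal_apply, one_apply]
  map_mul' a b := by
    ext i j
    simp only [ofMatrix_apply, Matrix.diagonal_apply, mul_apply]
    simp
  map_zero' := by
    ext i j
    simp
  map_add' a b := by
    ext i j
    by_cases h : i = j <;> simp [h]
  commutes' r := by
    ext i j
    simp only [ofMatrix_apply, Matrix.diagonal_apply, algebraMap_apply]
  map_star' a := by
    ext i j
    by_cases h : i = j
    · simp [star_apply, h]
    · simp [star_apply, h, Ne.symm h]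

theorem diagonalStarAlgHom_apply (a : A) (i j : m) :
    diagonalStarAlgHom m A a i j = if i = j then a else 0 := by
  change Matrix.diagonal (fun _ => a) i j = _
  rw [Matrix.diagonal_apply]

theorem unit_mul_diagonal_mul_unit (a : A) (i₀ i j p q : m) :
    (unit A i i₀ * diagonalStarAlgHom m A a * unit A i₀ j) p q =
      if i = p ∧ j = q then a else 0 := by
  simp only [mul_apply, unit_apply, diagonalStarAlgHom_apply, mul_ite, mul_one, mul_zero]
  by_cases hp : i = p <;> by_cases hq : j = q <;> simp [hp, hq]

theorem sum_unit_mul_diagonal_mul_unit (C : CStarMatrix m m A) (i₀ : m) :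
    ∑ i, ∑ j, unit A i i₀ * diagonalStarAlgHom m A (C i j) * unit A i₀ j = C := by
  ext p q
  simp only [sum_entry, unit_mul_diagonal_mul_unit, ite_and]
  rw [Finset.sum_eq_single p (fun i _ hi => by simp [hi]) (by simp),
    Finset.sum_eq_single q (fun j _ hj => by simp [hj]) (by simp)]
  simp

end MatrixUnits

variable {A : Type u} [CStarAlgebra A] [PartialOrder A] [StarOrderedRing A]
  {m : Type v} [Fintype m]

theorem norm_map_starAlgHom_le {B : Type*} [CStarAlgebra B] [PartialOrder B] [StarOrderedRing B]
    (π : A →⋆ₐ[ℂ] B) (C : CStarMatrix m m A) : ‖C.map π‖ ≤ ‖C‖ :=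
  NonUnitalStarAlgHom.norm_apply_le
    (mapₙₐ (n := m) ((π : A →⋆ₙₐ[ℂ] B))) C

theorem norm_diagonalStarAlgHom_le [DecidableEq m] (a : A) : ‖diagonalStarAlgHom m A a‖ ≤ ‖a‖ :=
  NonUnitalStarAlgHom.norm_apply_le (diagonalStarAlgHom m A) a

end CStarMatrix

/-! ### Compressions of representations -/

section CompressedRepresentation

variable {A : Type u} [CStarAlgebra A] {H : Type v} [NormedAddCommGroup H]
  [InnerProductSpace ℂ H] [CompleteSpace H]

theorem IsStarProjection.norm_le_one {B : Type*} [CStarAlgebra B] {p : B}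
    (hp : IsStarProjection p) : ‖p‖ ≤ 1 := by
  have h := CStarRing.norm_star_mul_self (x := p)
  rw [hp.isSelfAdjoint.star_eq, hp.isIdempotentElem.eq] at h
  nlinarith [norm_nonneg p]

/-- At level `k` the map is `C ↦ diag(Q) π_k(C) diag(P)`, and `π_k` is a ⋆-homomorphism, hence
contractive. -/
theorem isCompletelyContractive_compressedRep [PartialOrder A] [StarOrderedRing A]
    (π : A →⋆ₐ[ℂ] (H →L[ℂ] H)) {Q P : H →L[ℂ] H} (hQ : ‖Q‖ ≤ 1) (hP : ‖P‖ ≤ 1) :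
    IsCompletelyContractive (compressedRep π Q P) := by
  intro k C
  have h : C.map (compressedRep π Q P) =
      CStarMatrix.diagonalStarAlgHom (Fin k) (H →L[ℂ] H) Q * C.map π *
        CStarMatrix.diagonalStarAlgHom (Fin k) (H →L[ℂ] H) P := by
    refine CStarMatrix.ext fun i j => ?_
    simp only [CStarMatrix.mul_apply, CStarMatrix.diagonalStarAlgHom_apply,
      CStarMatrix.map_apply]
    simp [compressedRep]
  rw [h]
  calc _ ≤ ‖CStarMatrix.diagonalStarAlgHom (Fin k) (H →L[ℂ] H) Q‖ * ‖C.map π‖ *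
        ‖CStarMatrix.diagonalStarAlgHom (Fin k) (H →L[ℂ] H) P‖ :=
        (norm_mul_le _ _).trans (mul_le_mul_of_nonneg_right (norm_mul_le _ _) (norm_nonneg _))
    _ ≤ 1 * ‖C‖ * 1 := by
        gcongr
        · exact (CStarMatrix.norm_diagonalStarAlgHom_le Q).trans hQ
        · exact CStarMatrix.norm_map_starAlgHom_le π C
        · exact (CStarMatrix.norm_diagonalStarAlgHom_le P).trans hP
    _ = ‖C‖ := by ring

/-- The orthogonal projection onto the span of `n` vectors. -/
theorem exists_isStarProjection_rank_le {n : ℕ} (x : Fin n → H) :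
    ∃ P : H →L[ℂ] H, IsStarProjection P ∧ LinearMap.rank (P : H →ₗ[ℂ] H) ≤ n ∧
      (∀ i, P (x i) = x i) ∧ (∀ z, P z ∈ Submodule.span ℂ (Set.range x)) ∧
      ∀ w, (∀ i, ⟪x i, w⟫_ℂ = 0) → P w = 0 := by
  have : FiniteDimensional ℂ (Submodule.span ℂ (Set.range x)) :=
    FiniteDimensional.span_of_finite ℂ (Set.finite_range x)
  let K := Submodule.span ℂ (Set.range x)
  refine ⟨K.starProjection, isStarProjection_starProjection, ?_, fun i => ?_, fun z => ?_,
    fun w hw => ?_⟩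
  · have h : LinearMap.range (K.starProjection : H →ₗ[ℂ] H) ≤ K := by
      rintro _ ⟨z, rfl⟩
      exact Submodule.starProjection_apply_mem _ z
    refine (Submodule.rank_mono h).trans ?_
    rw [← Module.finrank_eq_rank]
    exact_mod_cast (finrank_range_le_card x).trans_eq (Fintype.card_fin n)
  · exact Submodule.starProjection_eq_self_iff.mpr (Submodule.subset_span ⟨i, rfl⟩)
  · exact Submodule.starProjection_apply_mem _ z
  · rw [Submodule.starProjection_apply_eq_zero_iff, Submodule.mem_orthogonal]
    intro u hu
    induction hu using Submodule.span_induction with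
    | mem u hu => obtain ⟨i, rfl⟩ := hu; exact hw i
    | zero => exact inner_zero_left _
    | add u v _ _ hu hv => rw [inner_add_left, hu, hv, add_zero]
    | smul c u _ hu => rw [inner_smul_left, hu, mul_zero]

end CompressedRepresentation

/-! ### Representations of matrix algebras in coordinates -/

section MatrixRepresentation

variable {A : Type u} [CStarAlgebra A]
  {m : Type v} [Fintype m] [DecidableEq m]
  {H : Type*} [NormedAddCommGroup H] [InnerProductSpace ℂ H] [CompleteSpace H]

/-- Since `e_{0i}⋆ e_{0i} = e_{ii}`, the terms are `⟪x, ρ(e_{ii}) x⟫`, and the `e_{ii}` sum to `1`.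
-/
theorem sum_norm_sq_unit_apply (ρ : CStarMatrix m m A →⋆ₐ[ℂ] (H →L[ℂ] H)) (i₀ : m) (x : H) :
    ∑ i, ‖ρ (CStarMatrix.unit A i₀ i) x‖ ^ 2 = ‖x‖ ^ 2 := by
  have h (i : m) : ((‖ρ (CStarMatrix.unit A i₀ i) x‖ ^ 2 : ℝ) : ℂ) =
      ⟪x, ρ (CStarMatrix.unit A i i) x⟫_ℂ := by
    rw [← CStarMatrix.unit_mul_unit i i₀ i, map_mul, ← CStarMatrix.star_unit i₀ i, map_star,
      mul_apply_eq_comp, ContinuousLinearMap.star_eq_adjoint,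
      ContinuousLinearMap.adjoint_inner_right, inner_self_eq_norm_sq_to_K]
    simp
  have hsum : ((∑ i, ‖ρ (CStarMatrix.unit A i₀ i) x‖ ^ 2 : ℝ) : ℂ) = ((‖x‖ ^ 2 : ℝ) : ℂ) := by
    rw [Complex.ofReal_sum]
    simp_rw [h]
    rw [← inner_sum, ← sum_apply, ← map_sum, CStarMatrix.sum_unit_diag,
      map_one, one_apply_eq_self, inner_self_eq_norm_sq_to_K]
    simp
  exact_mod_cast hsum

theorem inner_apply_eq_sum_unit (ρ : CStarMatrix m m A →⋆ₐ[ℂ] (H →L[ℂ] H)) (i₀ : m) (x y : H) (C : CStarMatrix m m A) :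
    ⟪y, ρ C x⟫_ℂ = ∑ i, ∑ j, ⟪ρ (CStarMatrix.unit A i₀ i) y,
      ρ (CStarMatrix.diagonalStarAlgHom m A (C i j)) (ρ (CStarMatrix.unit A i₀ j) x)⟫_ℂ := by
  conv_lhs => rw [← CStarMatrix.sum_unit_mul_diagonal_mul_unit C i₀]
  simp only [map_sum, sum_apply, inner_sum]
  refine Finset.sum_congr rfl fun i _ => Finset.sum_congr rfl fun j _ => ?_
  rw [map_mul, map_mul, ← CStarMatrix.star_unit i₀ i, map_star, mul_apply_eq_comp,
    mul_apply_eq_comp, ContinuousLinearMap.star_eq_adjoint,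
    ContinuousLinearMap.adjoint_inner_right]

end MatrixRepresentation

/-! ### Assembly of the representation and the projections -/

theorem proposition1p1 {A : Type u} [CStarAlgebra A] [PartialOrder A] [StarOrderedRing A]
    (V : Submodule ℂ A) (hV : IsClosed (V : Set A)) (n : ℕ)
    (ψ : StrongDual ℂ (CStarMatrix (Fin n) (Fin n) A))
    (hψV : ∀ C : CStarMatrix (Fin n) (Fin n) A, (∀ i j, C i j ∈ V) → ψ C = 0)
    (hψ : ‖ψ‖ = 1) :
    ∃ (H : Type u) (_ : NormedAddCommGroup H) (_ : InnerProductSpace ℂ H) (_ : CompleteSpace H)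
      (π : A →⋆ₐ[ℂ] (H →L[ℂ] H)) (P Q : H →L[ℂ] H),
      IsStarProjection P ∧ IsStarProjection Q ∧
      LinearMap.rank (P : H →ₗ[ℂ] H) ≤ n ∧ LinearMap.rank (Q : H →ₗ[ℂ] H) ≤ n ∧
      IsCompletelyContractive (compressedRep π Q P) ∧
      (∀ D ∈ V, compressedRep π Q P D = 0) ∧
      ∃ ξ η : PiLp 2 (fun _ : Fin n => H), ‖ξ‖ = 1 ∧ ‖η‖ = 1 ∧
        ∀ C : CStarMatrix (Fin n) (Fin n) A,
          ψ C = inner ℂ η (operatorMatrixApply (C.map (compressedRep π Q P)) ξ) := by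
  obtain ⟨H, _, _, _, ρ, x, y, hx, hy, hρ⟩ := exists_representation_eq_inner hψ
  have hn : n ≠ 0 := by
    rintro rfl
    have : ψ = 0 := ContinuousLinearMap.ext fun C => hψV C fun i => i.elim0
    simp [this] at hψ
  let i₀ : Fin n := ⟨0, Nat.pos_of_ne_zero hn⟩
  let π : A →⋆ₐ[ℂ] (H →L[ℂ] H) := ρ.comp (CStarMatrix.diagonalStarAlgHom (Fin n) A)
  let u (i : Fin n) : H := ρ (CStarMatrix.unit A i₀ i) x
  let w (i : Fin n) : H := ρ (CStarMatrix.unit A i₀ i) y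
  have hψ_sum (C : CStarMatrix (Fin n) (Fin n) A) :
      ψ C = ∑ i, ∑ j, ⟪w i, π (C i j) (u j)⟫_ℂ :=
    (hρ C).trans (inner_apply_eq_sum_unit ρ i₀ x y C)
  obtain ⟨P, hP, hPn, hPu, hPmem, -⟩ := exists_isStarProjection_rank_le u
  obtain ⟨Q, hQ, hQn, hQw, -, hQ0⟩ := exists_isStarProjection_rank_le w
  have hunit (z : H) (hz : ‖z‖ = 1) :
      ‖(WithLp.toLp 2 fun i => ρ (CStarMatrix.unit A i₀ i) z : PiLp 2 fun _ : Fin n => H)‖ = 1 := by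
    rw [PiLp.norm_eq_of_L2]
    simp [sum_norm_sq_unit_apply, hz]
  refine ⟨H, inferInstance, inferInstance, inferInstance, π, P, Q, hP, hQ, hPn, hQn,
    isCompletelyContractive_compressedRep π hQ.norm_le_one hP.norm_le_one, fun D hD => ?_,
    WithLp.toLp 2 u, WithLp.toLp 2 w, hunit x hx, hunit y hy, fun C => ?_⟩
  · have horth (i j : Fin n) : ⟪w i, π D (u j)⟫_ℂ = 0 := by
      have h := hψ_sum (CStarMatrix.ofMatrix (Matrix.single i j D))
      rw [hψV _ fun p q => by
        rw [CStarMatrix.ofMatrix_apply, Matrix.single_apply]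
        split_ifs
        exacts [hD, V.zero_mem]] at h
      rw [h, Finset.sum_eq_single i (fun p _ hp => Finset.sum_eq_zero fun q _ => by
        simp [hp.symm]) (by simp),
        Finset.sum_eq_single j (fun q _ hq => by simp [hq.symm]) (by simp)]
      simp
    -- `P z` lies in the span of the `u j`, and `Q` kills whatever is orthogonal to all `w i`.
    ext z
    change Q (π D (P z)) = 0
    have hz := hPmem z
    generalize P z = v at hz ⊢
    induction hz using Submodule.span_induction with
    | mem v hv =>
      obtain ⟨j, rfl⟩ := hv
      exact hQ0 _ fun i => horth i j
    | zero => simp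
    | add v v' _ _ hv hv' => rw [map_add, map_add, hv, hv', add_zero]
    | smul c v _ hv => rw [map_smul, map_smul, hv, smul_zero]
  · rw [hψ_sum, PiLp.inner_apply]
    refine Finset.sum_congr rfl fun i _ => ?_
    change _ = ⟪w i, ∑ j, Q (π (C i j) (P (u j)))⟫_ℂ
    rw [inner_sum]
    refine Finset.sum_congr rfl fun j _ => ?_
    -- `P` fixes each `u j`; the self-adjoint `Q` moves to the left and fixes `w i`.
    rw [hPu, ← ContinuousLinearMap.adjoint_inner_left Q, ← ContinuousLinearMap.star_eq_adjoint,
      hQ.isSelfAdjoint.star_eq, hQw]
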